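/- Let $\mathbb T^n=(\mathbb R/2\pi\mathbb Z)^n$ with normalized Haar measure, let $|\cdot|$ be the Euclidean norm, and let $P\in\mathbb R^{d\times n}$ have $\mathbb Q$-linearly independent columns. Formal Fourier series on $\mathbb T^n$ with vanishing zeroth coefficient are written $U=\sum_{k\in\mathbb Z^n\setminus\{0\}}\widehat U_k e^{\mathrm i k^\top y}$, with $\widehat U_k\in\mathbb C$. For $r\in\mathbb R$ put $$H_0^r(\mathbb T^n)=\Big\{U:\sum_{k\ne0}(1+|k|^2)^r|\widehat U_k|^2<\infty\Big\},\qquad \overline H_{P,0}^r(\mathbb T^n)=\Big\{U:\sum_{k\neq 0}|Pk|^{2r}|\widehat U_k|^2<\infty\Big\}.$$ For $U\in\overline H^1_{P,0}(\mathbb T^n)$ let $P\nabla U\in L^2(\mathbb T^n;\mathbb C^d)$ be the field with Fourier coefficients $\mathrm i\,(Pk)\,\widehat U_k$. For a measurable function $A:\mathbb T^n\to\mathbb R$ put $$a(U,V)=\int_{\mathbb T^n}A\,P\nabla U\cdot\overline{P\nabla V}\,dy,\qquad \langle F,V\rangle=\sum_{k\neq0}\widehat F_k\overline{\widehat V_k}.$$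 **Theorem.** Let $s\ge0$, $c>0$, $\tau>0$, $0<\alpha_0\le\alpha_1<\infty$, and $N>n+s+\tau$. Assume that * $|Pk|\ge c|k|^{-\tau}$ for all $k\in\mathbb Z^n\setminus\{0\}$; * $\alpha_0\le A(y)\le\alpha_1$ for all $y\in\mathbb T^n$; * for some constant $C_A>0$, the Fourier coefficients $\widehat A_k=\int_{\mathbb T^n}A(y)e^{-\mathrm i k^\top y}\,dy$ satisfy $|\widehat A_k|\le C_A(1+|k|)^{-N}$ for all $k\in\mathbb Z^n$. Then for every $F\in H_0^{2\tau+s}(\mathbb T^n)$ there is exactly one $U\in\overline H^1_{P,0}(\mathbb T^n)$ such that $$a(U,V)=\langle F,V\rangle\qquad\text{for all }V\in\overline H^1_{P,0}(\mathbb T^n)$$ (the series $\langle F,V\rangle$ being absolutely convergent), and this solution belongs to $H_0^s(\mathbb T^n)$. -/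

import Mathlib

open MeasureTheory

open scoped ComplexConjugate Real

noncomputable section

namespace Quasiperiodic

instance fact_two_pi_pos : Fact (0 < 2 * π) := ⟨Real.two_pi_pos⟩

/-! ### The torus, its characters and Fourier coefficients -/

/-- The torus `𝕋ⁿ = (ℝ / 2πℤ)ⁿ`. -/
abbrev Torus (n : ℕ) : Type := Fin n → AddCircle (2 * π)

/-- The normalized Haar (i.e. Lebesgue) measure on `𝕋ⁿ`, of total mass one. -/
def torusMeasure (n : ℕ) : Measure (Torus n) :=
  Measure.pi fun _ => AddCircle.haarAddCircle

instance (n : ℕ) : IsProbabilityMeasure (torusMeasure n) := by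
  unfold torusMeasure; infer_instance

/-- The character `y ↦ e^{i k·y}` of `𝕋ⁿ`, for `k ∈ ℤⁿ`. -/
def character {n : ℕ} (k : Fin n → ℤ) : C(Torus n, ℂ) where
  toFun y := ∏ i, fourier (k i) (y i)
  continuous_toFun := by fun_prop

/-- The characters are indeed `y ↦ e^{i k·y}`. -/
theorem character_coe {n : ℕ} (k : Fin n → ℤ) (y : Fin n → ℝ) :
    character k (fun i => (y i : AddCircle (2 * π)))
      = Complex.exp (Complex.I * ((∑ i, (k i : ℝ) * y i : ℝ) : ℂ)) := by
  have hpi : (π : ℂ) ≠ 0 := Complex.ofReal_ne_zero.mpr Real.pi_ne_zero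
  simp only [character, ContinuousMap.coe_mk, fourier_coe_apply, ← Complex.exp_sum]
  congr 1
  push_cast
  rw [Finset.mul_sum]
  refine Finset.sum_congr rfl fun i _ => ?_
  field_simp

/-- The Fourier coefficient `f̂_k = ∫ f(y) e^{-i k·y} dy` (normalized measure) of `f : 𝕋ⁿ → ℂ`. -/
def fourierCoefficient {n : ℕ} (f : Torus n → ℂ) (k : Fin n → ℤ) : ℂ :=
  ∫ y, f y * conj (character k y) ∂(torusMeasure n)

/-- The character `e^{i k·y}` as an element of `L²(𝕋ⁿ)`. -/
def characterL2 {n : ℕ} (k : Fin n → ℤ) : Lp ℂ 2 (torusMeasure n) :=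
  ContinuousMap.toLp (E := ℂ) 2 (torusMeasure n) ℂ (character k)

/-- A formal Fourier series `∑_k Û_k e^{i k·y}` on `𝕋ⁿ`, given by its coefficients `k ↦ Û_k`.
Square-summable ones are the functions in `L²(𝕋ⁿ)`, see `L2Function`. -/
abbrev FourierSeries (n : ℕ) : Type := (Fin n → ℤ) → ℂ

/-- The function in `L²(𝕋ⁿ)` which is the sum of the Fourier series with square-summable
coefficients `c` (the series converges in `L²`, see `hasSum_L2Function`). -/
def L2Function {n : ℕ} (c : FourierSeries n) : Lp ℂ 2 (torusMeasure n) :=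
  ∑' k, c k • characterL2 k

theorem orthonormal_characterL2 (n : ℕ) :
    Orthonormal ℂ (characterL2 : (Fin n → ℤ) → Lp ℂ 2 (torusMeasure n)) := by
  rw [orthonormal_iff_ite]
  intro k l
  unfold characterL2
  rw [ContinuousMap.inner_toLp]
  have key : ∀ y : Torus n, character l y * conj (character k y)
      = ∏ i, fourier (l i - k i) (y i) := by
    intro y
    simp only [character, ContinuousMap.coe_mk, map_prod, ← Finset.prod_mul_distrib,
      ← fourier_neg, ← fourier_add, sub_eq_add_neg]
  simp only [key, torusMeasure]
  rw [integral_fintype_prod_eq_prod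
    (f := fun i => (fourier (l i - k i) : AddCircle (2 * π) → ℂ))]
  have h1 : ∀ m : ℤ, ∫ x : AddCircle (2 * π), fourier m x ∂AddCircle.haarAddCircle
      = if m = 0 then 1 else 0 := by
    intro m
    have h := orthonormal_iff_ite.mp (orthonormal_fourier (T := 2 * π)) 0 m
    rw [ContinuousMap.inner_toLp] at h
    simpa [eq_comm] using h
  simp only [h1, sub_eq_zero]
  split_ifs with h
  · subst h; simp
  · obtain ⟨i, hi⟩ := Function.ne_iff.mp h
    exact Finset.prod_eq_zero (Finset.mem_univ i) (if_neg fun h' => hi h'.symm)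

theorem hasSum_L2Function {n : ℕ} {c : FourierSeries n} (hc : Summable fun k => ‖c k‖ ^ 2) :
    HasSum (fun k => c k • characterL2 k) (L2Function c) := by
  refine Summable.hasSum ?_
  have h := (orthonormal_characterL2 n).orthogonalFamily.summable_iff_norm_sq_summable
    (fun k => c k)
  simpa using h.mpr (by simpa using hc)

/-! ### The matrix `P` -/

/-- The projection matrices: real `d × n` matrices with `ℚ`-linearly independent columns. -/
def IsProjectionMatrix {d n : ℕ} (P : Matrix (Fin d) (Fin n) ℝ) : Prop :=
  LinearIndependent ℚ fun i : Fin n => P.col i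

/-- The frequency `k ∈ ℤⁿ` as a vector of Euclidean space `ℝⁿ`, so that `‖freq k‖ = |k|`. -/
def freq {n : ℕ} (k : Fin n → ℤ) : EuclideanSpace ℝ (Fin n) :=
  WithLp.toLp 2 fun i => (k i : ℝ)

/-- The projected frequency `P k` as a vector of Euclidean space `ℝᵈ`. -/
def projFreq {d n : ℕ} (P : Matrix (Fin d) (Fin n) ℝ) (k : Fin n → ℤ) :
    EuclideanSpace ℝ (Fin d) :=
  WithLp.toLp 2 (P.mulVec fun i => (k i : ℝ))

/-- The Diophantine estimate `|P k| ≥ c |k|^{-τ}` for all `k ∈ ℤⁿ \ {0}`. -/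
def IsDiophantine {d n : ℕ} (P : Matrix (Fin d) (Fin n) ℝ) (c τ : ℝ) : Prop :=
  ∀ k : Fin n → ℤ, k ≠ 0 → c * ‖freq k‖ ^ (-τ) ≤ ‖projFreq P k‖

/-! ### Spaces of periodic functions

The mean-zero spaces consist of the series with `Û_0 = 0`; then the term `k = 0` of the sums
below vanishes and they are sums over `ℤⁿ \ {0}`. -/

/-- The mean-zero Sobolev space `H₀ˢ(𝕋ⁿ)`: `∑_{k ≠ 0} (1 + |k|²)ˢ |Û_k|² < ∞`. -/
def sobolevZero (n : ℕ) (s : ℝ) : Set (FourierSeries n) :=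
  {U | U 0 = 0 ∧ Summable fun k => (1 + ‖freq k‖ ^ 2) ^ s * ‖U k‖ ^ 2}

/-- The homogeneous mean-zero `P`-projected Sobolev space `H̄ˢ_{P,0}(𝕋ⁿ)`:
`∑_{k ≠ 0} |P k|^{2s} |Û_k|² < ∞`. -/
def projSobolevZero {d n : ℕ} (P : Matrix (Fin d) (Fin n) ℝ) (s : ℝ) : Set (FourierSeries n) :=
  {U | U 0 = 0 ∧ Summable fun k => ‖projFreq P k‖ ^ (2 * s) * ‖U k‖ ^ 2}

/-! ### The variational problem -/

/-- The `j`-th component of `P∇U`, the function in `L²(𝕋ⁿ)` with Fourier coefficients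
`i (P k)_j Û_k`, for `U ∈ H̄¹_{P,0}(𝕋ⁿ)`. -/
def projGrad {d n : ℕ} (P : Matrix (Fin d) (Fin n) ℝ) (U : FourierSeries n) (j : Fin d) :
    Lp ℂ 2 (torusMeasure n) :=
  L2Function fun k => Complex.I * (projFreq P k j : ℂ) * U k

/-- The components of `P∇U` are given by `L²`-convergent series. -/
theorem hasSum_projGrad {d n : ℕ} {P : Matrix (Fin d) (Fin n) ℝ} {U : FourierSeries n}
    (hU : U ∈ projSobolevZero P 1) (j : Fin d) :
    HasSum (fun k => (Complex.I * (projFreq P k j : ℂ) * U k) • characterL2 k)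
      (projGrad P U j) := by
  refine hasSum_L2Function (hU.2.of_nonneg_of_le (fun k => by positivity) fun k => ?_)
  have h : ‖projFreq P k j‖ ≤ ‖projFreq P k‖ := PiLp.norm_apply_le _ _
  have h2 : ‖projFreq P k‖ ^ (2 * (1 : ℝ)) = ‖projFreq P k‖ ^ 2 := by
    rw [mul_one]; exact_mod_cast Real.rpow_natCast _ 2
  rw [h2, norm_mul, norm_mul, Complex.norm_I, one_mul, Complex.norm_real, mul_pow]
  gcongr

/-- The form `a(U, V) = (A P∇U, P∇V) = ∫ A (P∇U) · conj (P∇V)`, linear in `U` and conjugate-linear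
in `V`. -/
def energyForm {d n : ℕ} (P : Matrix (Fin d) (Fin n) ℝ) (A : Torus n → ℝ)
    (U V : FourierSeries n) : ℂ :=
  ∫ y, (A y : ℂ) * ∑ j, projGrad P U j y * conj (projGrad P V j y) ∂(torusMeasure n)

/-- `U` solves the variational problem: `U ∈ H̄¹_{P,0}(𝕋ⁿ)` and `a(U, V) = ⟨F, V⟩` for all
`V ∈ H̄¹_{P,0}(𝕋ⁿ)`, where `⟨F, V⟩ = ∑_k F̂_k conj V̂_k` (an absolutely convergent sum). -/
def IsSolution {d n : ℕ} (P : Matrix (Fin d) (Fin n) ℝ) (A : Torus n → ℝ)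
    (F U : FourierSeries n) : Prop :=
  U ∈ projSobolevZero P 1 ∧
    ∀ V ∈ projSobolevZero P 1, HasSum (fun k => F k * conj (V k)) (energyForm P A U V)

/-- The Fourier coefficients of `A` decay with rate `N`: `|Â_k| ≤ C (1 + |k|)^{-N}`. -/
def HasFourierDecay {n : ℕ} (A : Torus n → ℝ) (N : ℝ) : Prop :=
  ∃ C > 0, ∀ k, ‖fourierCoefficient (fun y => (A y : ℂ)) k‖ ≤ C * (1 + ‖freq k‖) ^ (-N)

end Quasiperiodic

end

open MeasureTheory Filter Topology

open scoped ComplexConjugate Real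

noncomputable section

namespace Quasiperiodic

/-! ### Lattice sums -/

/-! In the unknown `w_k = |Pk| Û_k` the problem becomes `T w = g` on ℓ² over the nonzero
frequencies, with `g_k = F̂_k / |Pk|`. With `e_k = Pk / |Pk|`, the matrix of `T` is `⟨e_k, e_l⟩
Â_{k-l}`, so no small divisor is left in the operator: it is bounded, coercive with constant `α₀`
(`le_re_inner_energyOperator`), and dominated entrywise by `|Â_{k-l}|`
(`norm_energyOperator_entry_le`). Coercivity makes `T` invertible, which gives existence and
uniqueness.

Regularity means passing the weight `(1 + |k|)^(s+τ)` from `g` to `w`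
(`summable_weighted_of_coercive`). For a weight `ω`, test the equation with `ω² w`. Moving one
factor `ω` across `T` produces a commutator, which the Schur test (`summable_convolution_kernel`)
controls. The weight `(1 + ε|k|)^(s+τ)` varies so slowly for small `ε` that coercivity absorbs the
commutator. Truncating the weight at height `R` keeps the absorbed quantity finite, and the
resulting bound does not depend on `R`. The condition `N > n + s + τ` makes `∑ (1 + |m|)^(-N) (1 +
|m|)^(s+τ)` finite, as the commutator bound requires.

The Diophantine rate is paid only at the two ends: `F ↦ g` lowers the order from `2τ + s` to `s +
τ`, and `w ↦ U` lowers it to `s`. -/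

theorem freq_add {n : ℕ} (k l : Fin n → ℤ) : freq (k + l) = freq k + freq l := by
  ext i; simp [freq]

theorem freq_neg {n : ℕ} (k : Fin n → ℤ) : freq (-k) = -freq k := by
  ext i; simp [freq]

theorem freq_injective (n : ℕ) : Function.Injective (freq : (Fin n → ℤ) → _) := by
  intro k l h
  ext i
  have := congrArg (fun v : EuclideanSpace ℝ (Fin n) => v i) h
  simpa [freq] using this

theorem norm_freq_pos {n : ℕ} {k : Fin n → ℤ} (hk : k ≠ 0) : 0 < ‖freq k‖ := by
  rw [norm_pos_iff]
  intro h
  exact hk (freq_injective n (by rw [h]; ext i; simp [freq]))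

/-- `∑_k (1 + |k|)^{-p}` converges over `ℤⁿ` for `p > n`. -/
theorem summable_one_add_norm_freq_rpow {n : ℕ} {p : ℝ} (hp : (n : ℝ) < p) :
    Summable fun k : Fin n → ℤ => (1 + ‖freq k‖) ^ (-p) := by
  let b := (EuclideanSpace.basisFun (Fin n) ℝ).toBasis
  let L : Submodule ℤ (EuclideanSpace ℝ (Fin n)) := Submodule.span ℤ (Set.range b)
  have hL : Module.finrank ℤ L = n := by
    rw [Module.finrank_eq_card_basis (b.restrictScalars ℤ)]; simp
  have hmem : ∀ k : Fin n → ℤ, freq k ∈ L := by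
    intro k
    refine (b.mem_span_iff_repr_mem ℤ _).2 fun i => ?_
    exact ⟨k i, by simp [b, freq]⟩
  have hs : Summable fun z : L => ‖z‖ ^ (-p) :=
    ZLattice.summable_norm_rpow L (-p) (by rw [hL]; linarith)
  have hinj : Function.Injective fun k : Fin n → ℤ => (⟨freq k, hmem k⟩ : L) := fun k l h =>
    freq_injective n (congrArg Subtype.val h)
  -- The comparison fails at `k = 0`, where `0 ^ (-p) = 0` but the left side is `1`; one exceptional
  -- point is harmless.
  refine Summable.of_norm_bounded_eventually (hs.comp_injective hinj) ?_
  have h0 : ({0}ᶜ : Set (Fin n → ℤ)) ∈ cofinite := (Set.finite_singleton 0).compl_mem_cofinite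
  filter_upwards [h0] with k hk
  have hk' := norm_freq_pos (n := n) (k := k) hk
  rw [Real.norm_of_nonneg (by positivity)]
  have hn : (0 : ℝ) ≤ n := by positivity
  exact Real.rpow_le_rpow_of_nonpos hk' (le_add_of_nonneg_left zero_le_one) (by linarith)

/-! ### A Schur test and weighted estimates for matrices with off-diagonal decay -/

/-- The Schur test for convolution kernels. -/
theorem summable_convolution_kernel {G ι : Type*} [AddCommGroup G] {φ : ι → G}
    (hφ : Function.Injective φ) {a : G → ℝ} (ha : ∀ m, 0 ≤ a m) (hs : Summable a)
    {x : ι → ℝ} (hx : ∀ i, 0 ≤ x i) (hxs : Summable fun i => x i ^ 2) :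
    Summable (fun p : ι × ι => a (φ p.2 - φ p.1) * (x p.1 * x p.2)) ∧
      ∑' p : ι × ι, a (φ p.2 - φ p.1) * (x p.1 * x p.2) ≤ (∑' m, a m) * ∑' i, x i ^ 2 := by
  have hbase : Summable fun q : G × ι => a q.1 * x q.2 ^ 2 :=
    hs.mul_of_nonneg hxs ha fun i => sq_nonneg _
  have hbase_sum : ∑' q : G × ι, a q.1 * x q.2 ^ 2 = (∑' m, a m) * ∑' i, x i ^ 2 :=
    (hs.tsum_mul_tsum hxs hbase).symm
  -- By `xy ≤ (x² + y²)/2` it suffices to sum `a (φ j - φ i)` against one square. Pairing the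
  -- difference with either index embeds `ι × ι` in `G × ι`, where the sum factorizes; `ι` itself
  -- need not be a group.
  have hi1 : Function.Injective fun p : ι × ι => (φ p.2 - φ p.1, p.2) := by
    rintro ⟨i, j⟩ ⟨i', j'⟩ h
    simp only [Prod.mk.injEq] at h
    obtain ⟨h1, rfl⟩ := h
    rw [hφ (sub_right_injective h1)]
  have hi2 : Function.Injective fun p : ι × ι => (φ p.2 - φ p.1, p.1) := by
    rintro ⟨i, j⟩ ⟨i', j'⟩ h
    simp only [Prod.mk.injEq] at h
    obtain ⟨h1, rfl⟩ := h
    rw [hφ (sub_left_injective h1)]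
  have hnn : ∀ q : G × ι, 0 ≤ a q.1 * x q.2 ^ 2 := fun q => mul_nonneg (ha _) (sq_nonneg _)
  have h1 : Summable fun p : ι × ι => a (φ p.2 - φ p.1) * x p.2 ^ 2 := by
    have h := hbase.comp_injective hi1
    simpa only [Function.comp_def] using h
  have h2 : Summable fun p : ι × ι => a (φ p.2 - φ p.1) * x p.1 ^ 2 := by
    have h := hbase.comp_injective hi2
    simpa only [Function.comp_def] using h
  have t1 : ∑' p : ι × ι, a (φ p.2 - φ p.1) * x p.2 ^ 2 ≤ ∑' q : G × ι, a q.1 * x q.2 ^ 2 :=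
    by simpa only [Function.comp_def] using tsum_comp_le_tsum_of_inj hbase hnn hi1
  have t2 : ∑' p : ι × ι, a (φ p.2 - φ p.1) * x p.1 ^ 2 ≤ ∑' q : G × ι, a q.1 * x q.2 ^ 2 :=
    by simpa only [Function.comp_def] using tsum_comp_le_tsum_of_inj hbase hnn hi2
  have hle : ∀ p : ι × ι, a (φ p.2 - φ p.1) * (x p.1 * x p.2)
      ≤ (1 / 2 : ℝ) * (a (φ p.2 - φ p.1) * x p.2 ^ 2 + a (φ p.2 - φ p.1) * x p.1 ^ 2) := by
    intro p
    nlinarith [mul_nonneg (ha (φ p.2 - φ p.1)) (sq_nonneg (x p.1 - x p.2))]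
  have hsum := (h1.add h2).mul_left (1 / 2 : ℝ)
  have hS : Summable (fun p : ι × ι => a (φ p.2 - φ p.1) * (x p.1 * x p.2)) :=
    hsum.of_nonneg_of_le (fun p => mul_nonneg (ha _) (mul_nonneg (hx _) (hx _))) hle
  refine ⟨hS, (hS.tsum_le_tsum hle hsum).trans ?_⟩
  rw [tsum_mul_left, h1.tsum_add h2]
  rw [hbase_sum] at t1 t2
  linarith

/-- The matrix of a bounded operator on `ℓ²` represents its sesquilinear form. -/
theorem inner_apply_eq_tsum_tsum {ι : Type*} [DecidableEq ι]
    (T : lp (fun _ : ι => ℂ) 2 →L[ℂ] lp (fun _ : ι => ℂ) 2) (v w : lp (fun _ : ι => ℂ) 2) :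
    inner ℂ v (T w) = ∑' l, ∑' k, conj (v k) * w l *
      inner ℂ (lp.single 2 k (1 : ℂ)) (T (lp.single 2 l (1 : ℂ))) := by
  have hw : HasSum (fun l => lp.single 2 l (w l)) w := lp.hasSum_single (by simp) w
  have h1 := (hw.mapL T).mapL (innerSL ℂ v)
  simp only [innerSL_apply_apply] at h1
  rw [← h1.tsum_eq]
  refine tsum_congr fun l => ?_
  have hl : lp.single 2 l (w l) = w l • (lp.single 2 l (1 : ℂ) : lp (fun _ : ι => ℂ) 2) := by
    rw [← lp.single_smul]; simp
  rw [hl, map_smul, inner_smul_right, lp.inner_eq_tsum, ← tsum_mul_left]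
  refine tsum_congr fun k => ?_
  rw [lp.inner_single_left]
  simp only [RCLike.inner_apply, map_one]
  ring

theorem summable_norm_sq_coe {ι : Type*} (w : lp (fun _ : ι => ℂ) 2) :
    Summable fun i => ‖w i‖ ^ 2 := by
  have h := (lp.memℓp w).summable (by simp)
  simpa using h

theorem norm_sq_eq_tsum {ι : Type*} (w : lp (fun _ : ι => ℂ) 2) :
    ‖w‖ ^ 2 = ∑' i, ‖w i‖ ^ 2 := by
  have h := lp.norm_rpow_eq_tsum (p := 2) (by simp) w
  simpa using h

theorem memℓp_two_of_summable {ι : Type*} {w : ι → ℂ} (h : Summable fun i => ‖w i‖ ^ 2) :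
    Memℓp w 2 :=
  memℓp_gen (by simpa using h)

/-- An operator on `ℓ²` with convolution-dominated matrix is given by an absolutely convergent
double sum. -/
theorem hasSum_matrix {G ι : Type*} [AddCommGroup G] [DecidableEq ι] {φ : ι → G}
    (hφ : Function.Injective φ) {a : G → ℝ} (ha : ∀ m, 0 ≤ a m) (hs : Summable a)
    (T : lp (fun _ : ι => ℂ) 2 →L[ℂ] lp (fun _ : ι => ℂ) 2)
    (hT : ∀ k l, ‖inner ℂ (lp.single 2 k (1 : ℂ) : lp (fun _ : ι => ℂ) 2)
      (T (lp.single 2 l (1 : ℂ)))‖ ≤ a (φ k - φ l))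
    (v w : lp (fun _ : ι => ℂ) 2) :
    HasSum (fun p : ι × ι => conj (v p.2) * w p.1 *
      inner ℂ (lp.single 2 p.2 (1 : ℂ) : lp (fun _ : ι => ℂ) 2) (T (lp.single 2 p.1 (1 : ℂ))))
      (inner ℂ v (T w)) := by
  -- The sum `‖v i‖ + ‖w i‖` dominates both vectors, so the Schur test for a single sequence
  -- suffices.
  have hx : Summable fun i => (‖v i‖ + ‖w i‖) ^ 2 := by
    refine Summable.of_nonneg_of_le (fun i => sq_nonneg _) (fun i => ?_)
      (((summable_norm_sq_coe v).add (summable_norm_sq_coe w)).mul_left 2)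
    nlinarith [sq_nonneg (‖v i‖ - ‖w i‖)]
  have hS := (summable_convolution_kernel hφ ha hs (fun i => by positivity) hx).1
  have hsum : Summable (fun p : ι × ι => conj (v p.2) * w p.1 *
      inner ℂ (lp.single 2 p.2 (1 : ℂ) : lp (fun _ : ι => ℂ) 2)
        (T (lp.single 2 p.1 (1 : ℂ)))) := by
    refine Summable.of_norm_bounded hS fun p => ?_
    rw [norm_mul, norm_mul, RCLike.norm_conj, mul_comm]
    refine mul_le_mul (hT _ _) ?_ (by positivity) (ha _)
    nlinarith [norm_nonneg (v p.1), norm_nonneg (v p.2), norm_nonneg (w p.1), norm_nonneg (w p.2),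
      mul_nonneg (norm_nonneg (v p.1)) (norm_nonneg (v p.2)),
      mul_nonneg (norm_nonneg (v p.1)) (norm_nonneg (w p.2)),
      mul_nonneg (norm_nonneg (w p.1)) (norm_nonneg (w p.2))]
  rw [inner_apply_eq_tsum_tsum T v w, ← hsum.tsum_prod]
  exact hsum.hasSum

/-- A-priori estimate in weighted `ℓ²` for a bounded weight which varies slowly compared with
the off-diagonal decay of the matrix. -/
theorem weighted_estimate_of_bounded_weight {G ι : Type*} [AddCommGroup G] [DecidableEq ι]
    {φ : ι → G} (hφ : Function.Injective φ) {a : G → ℝ} (ha : ∀ m, 0 ≤ a m) (hs : Summable a)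
    (T : lp (fun _ : ι => ℂ) 2 →L[ℂ] lp (fun _ : ι => ℂ) 2)
    (hT : ∀ k l, ‖inner ℂ (lp.single 2 k (1 : ℂ) : lp (fun _ : ι => ℂ) 2)
      (T (lp.single 2 l (1 : ℂ)))‖ ≤ a (φ k - φ l))
    {α : ℝ} (hα : 0 < α) (hcoer : ∀ v, α * ‖v‖ ^ 2 ≤ (inner ℂ v (T v)).re)
    {η : G → ℝ} (hη : ∀ m, 0 ≤ η m) (haη : Summable fun m => a m * η m)
    (hsmall : ∑' m, a m * η m ≤ α / 4)
    {ω : ι → ℝ} {R : ℝ} (hω : ∀ i, 0 ≤ ω i) (hωR : ∀ i, ω i ≤ R)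
    (hvar : ∀ k l, |ω l - ω k| ≤ ω l * η (φ k - φ l))
    (w : lp (fun _ : ι => ℂ) 2) (hg : Summable fun i => ω i ^ 2 * ‖T w i‖ ^ 2) :
    ∑' i, ω i ^ 2 * ‖w i‖ ^ 2 ≤ 2 / α ^ 2 * ∑' i, ω i ^ 2 * ‖T w i‖ ^ 2 := by
  have hw := summable_norm_sq_coe w
  -- Boundedness of `ω` puts `ω w` and `ω² w` in ℓ². The sum `S` below is then finite, so it can
  -- legitimately be absorbed.
  have hv_sum : Summable fun i => ω i ^ 2 * ‖w i‖ ^ 2 := by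
    refine Summable.of_nonneg_of_le (fun i => by positivity) (fun i => ?_) (hw.mul_left (R ^ 2))
    have := hω i
    have := hωR i
    gcongr
  have hu_sum : Summable fun i => ω i ^ 4 * ‖w i‖ ^ 2 := by
    refine Summable.of_nonneg_of_le (fun i => by positivity) (fun i => ?_) (hw.mul_left (R ^ 4))
    have := hω i
    have := hωR i
    gcongr
  let v : lp (fun _ : ι => ℂ) 2 := ⟨fun i => (ω i : ℂ) * w i,
    memℓp_two_of_summable (by simpa [mul_pow] using hv_sum)⟩
  let u : lp (fun _ : ι => ℂ) 2 := ⟨fun i => (ω i : ℂ) ^ 2 * w i,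
    memℓp_two_of_summable (by simpa [mul_pow, ← pow_mul] using hu_sum)⟩
  have hv : ∀ i, v i = (ω i : ℂ) * w i := fun i => rfl
  have hu : ∀ i, u i = (ω i : ℂ) ^ 2 * w i := fun i => rfl
  have hvn : ∀ i, ‖v i‖ = ω i * ‖w i‖ := fun i => by
    rw [hv, norm_mul, Complex.norm_real, Real.norm_of_nonneg (hω i)]
  set S := ∑' i, ω i ^ 2 * ‖w i‖ ^ 2 with hS
  set Γ := ∑' i, ω i ^ 2 * ‖T w i‖ ^ 2 with hΓ
  have hvS : ‖v‖ ^ 2 = S := by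
    rw [norm_sq_eq_tsum]; simp only [hvn, mul_pow, hS]
  have hS0 : 0 ≤ S := tsum_nonneg fun i => by positivity
  -- the commutator term
  have hcomm : ‖inner ℂ v (T v) - inner ℂ u (T w)‖ ≤ α / 4 * S := by
    have h := (hasSum_matrix hφ ha hs T hT v v).sub (hasSum_matrix hφ ha hs T hT u w)
    -- The `(k, l)` term of the difference carries `(ω l - ω k) ω k`, which `hvar` bounds by `ω k ω
    -- l η (φ k - φ l)`. This leaves the kernel `a η` acting on `‖v i‖`.
    have hK := summable_convolution_kernel hφ (fun m => mul_nonneg (ha m) (hη m)) haη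
      (x := fun i => ‖v i‖) (fun i => norm_nonneg _) (summable_norm_sq_coe v)
    rw [← norm_sq_eq_tsum, hvS] at hK
    rw [← h.tsum_eq]
    refine (tsum_of_norm_bounded hK.1.hasSum fun p => ?_).trans (hK.2.trans ?_)
    · have e : conj (v p.2) * v p.1 * inner ℂ (lp.single 2 p.2 (1 : ℂ) : lp (fun _ : ι => ℂ) 2)
            (T (lp.single 2 p.1 (1 : ℂ))) -
          conj (u p.2) * w p.1 * inner ℂ (lp.single 2 p.2 (1 : ℂ) : lp (fun _ : ι => ℂ) 2)
            (T (lp.single 2 p.1 (1 : ℂ)))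
          = ((ω p.1 - ω p.2 : ℝ) : ℂ) * ((ω p.2 : ℂ) * conj (w p.2) * w p.1) *
            inner ℂ (lp.single 2 p.2 (1 : ℂ) : lp (fun _ : ι => ℂ) 2)
            (T (lp.single 2 p.1 (1 : ℂ))) := by
        simp only [hv, hu, map_mul, map_pow, Complex.conj_ofReal]
        push_cast
        ring
      rw [e, norm_mul, norm_mul, norm_mul, norm_mul, RCLike.norm_conj, Complex.norm_real,
        Complex.norm_real, Real.norm_of_nonneg (hω p.2), hvn, hvn, Real.norm_eq_abs]
      have h1 := hvar p.2 p.1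
      have h2 := hT p.2 p.1
      have h3 := hω p.2
      calc _ ≤ (ω p.1 * η (φ p.2 - φ p.1)) * (ω p.2 * ‖w p.2‖ * ‖w p.1‖) *
            a (φ p.2 - φ p.1) := by
            have := mul_nonneg (hω p.1) (hη (φ p.2 - φ p.1))
            gcongr
        _ = _ := by ring
    · gcongr
  -- the right-hand side
  have hrhs : ‖inner ℂ u (T w)‖ ≤ Γ / α + α / 4 * S := by
    have hle : ∀ i, ‖inner ℂ (u i) (T w i)‖
        ≤ α⁻¹ * (ω i ^ 2 * ‖T w i‖ ^ 2) + α / 4 * (ω i ^ 2 * ‖w i‖ ^ 2) := by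
      intro i
      refine (norm_inner_le_norm _ _).trans ?_
      rw [hu, norm_mul, norm_pow, Complex.norm_real, Real.norm_of_nonneg (hω i)]
      -- Young's inequality, weighted to cost `α / 4 * S`; together with the commutator this leaves
      -- half of `α * S` on the left.
      have key : 0 ≤ α⁻¹ * (ω i * ‖T w i‖ - α / 2 * (ω i * ‖w i‖)) ^ 2 := by positivity
      have e : α⁻¹ * (ω i * ‖T w i‖ - α / 2 * (ω i * ‖w i‖)) ^ 2 =
          α⁻¹ * (ω i ^ 2 * ‖T w i‖ ^ 2) + α / 4 * (ω i ^ 2 * ‖w i‖ ^ 2)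
            - ω i ^ 2 * ‖w i‖ * ‖T w i‖ := by
        field_simp; ring
      linarith
    rw [lp.inner_eq_tsum]
    refine (tsum_of_norm_bounded ((hg.mul_left α⁻¹).add (hv_sum.mul_left (α / 4))).hasSum
      hle).trans ?_
    rw [(hg.mul_left α⁻¹).tsum_add (hv_sum.mul_left (α / 4)), tsum_mul_left, tsum_mul_left,
      ← hΓ, ← hS, div_eq_inv_mul Γ α]
  have hmain : α * S ≤ Γ / α + α / 4 * S + α / 4 * S := by
    have h1 := hcoer v
    rw [hvS] at h1
    have h2 : (inner ℂ v (T v)).re ≤ ‖inner ℂ u (T w)‖ + ‖inner ℂ v (T v) - inner ℂ u (T w)‖ := by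
      refine (Complex.re_le_norm _).trans ?_
      calc ‖inner ℂ v (T v)‖ = ‖inner ℂ u (T w) + (inner ℂ v (T v) - inner ℂ u (T w))‖ := by
            congr 1; ring
        _ ≤ _ := norm_add_le _ _
    linarith
  have h3 : α * S / 2 ≤ Γ / α := by linarith
  rw [le_div_iff₀ hα] at h3
  rw [div_mul_eq_mul_div, le_div_iff₀ (by positivity)]
  linarith

/-- Coercive operators whose matrix has sufficient off-diagonal decay are regular in `ℓ²` with
polynomial weights, in terms of an abstract length function `ν`. -/
theorem summable_weighted_of_coercive {G ι : Type*} [AddCommGroup G] [DecidableEq ι]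
    {φ : ι → G} (hφ : Function.Injective φ) {a ν : G → ℝ} (ha : ∀ m, 0 ≤ a m)
    (hν : ∀ m, 0 ≤ ν m) (hν_neg : ∀ m, ν (-m) = ν m) (hν_add : ∀ m m', ν (m + m') ≤ ν m + ν m')
    {r : ℝ} (hr : 0 ≤ r) (hs : Summable fun m => a m * (1 + ν m) ^ r)
    (T : lp (fun _ : ι => ℂ) 2 →L[ℂ] lp (fun _ : ι => ℂ) 2)
    (hT : ∀ k l, ‖inner ℂ (lp.single 2 k (1 : ℂ) : lp (fun _ : ι => ℂ) 2)
      (T (lp.single 2 l (1 : ℂ)))‖ ≤ a (φ k - φ l))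
    {α : ℝ} (hα : 0 < α) (hcoer : ∀ v, α * ‖v‖ ^ 2 ≤ (inner ℂ v (T v)).re)
    (w : lp (fun _ : ι => ℂ) 2)
    (hg : Summable fun i => ((1 + ν (φ i)) ^ r) ^ 2 * ‖T w i‖ ^ 2) :
    Summable fun i => ((1 + ν (φ i)) ^ r) ^ 2 * ‖w i‖ ^ 2 := by
  have hone : ∀ {x : ℝ}, 0 ≤ x → 1 ≤ (1 + x) ^ r := fun hx =>
    Real.one_le_rpow (by linarith) hr
  have ha_sum : Summable a := hs.of_nonneg_of_le ha fun m =>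
    le_mul_of_one_le_right (ha m) (hone (hν m))
  -- a slowly varying weight
  obtain ⟨ε, hε0, hε1, hε⟩ : ∃ ε : ℝ, 0 < ε ∧ ε ≤ 1 ∧
      ∑' m, a m * ((1 + ε * ν m) ^ r - 1) ≤ α / 4 := by
    -- Each term tends to `0` with `ε`, and `a m * (1 + ν m) ^ r` is a summable majorant for `ε ≤
    -- 1`.
    have hlim : Tendsto (fun ε : ℝ => ∑' m, a m * ((1 + ε * ν m) ^ r - 1)) (𝓝[>] 0)
        (𝓝 (∑' _ : G, (0 : ℝ))) := by
      refine tendsto_tsum_of_dominated_convergence hs (fun m => ?_) ?_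
      · have hc : ContinuousAt (fun ε : ℝ => a m * ((1 + ε * ν m) ^ r - 1)) 0 := by
          refine continuousAt_const.mul (ContinuousAt.sub ?_ continuousAt_const)
          exact ContinuousAt.rpow (by fun_prop) continuousAt_const (Or.inl (by simp))
        have := hc.tendsto.mono_left (nhdsWithin_le_nhds (s := Set.Ioi 0))
        simpa using this
      · filter_upwards [Ioc_mem_nhdsGT (zero_lt_one (α := ℝ))] with ε hε m
        have h0 : 0 ≤ ε * ν m := mul_nonneg hε.1.le (hν m)
        rw [Real.norm_of_nonneg (mul_nonneg (ha m) (by linarith [hone h0]))]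
        refine mul_le_mul_of_nonneg_left ?_ (ha m)
        have : (1 + ε * ν m) ^ r ≤ (1 + ν m) ^ r :=
          Real.rpow_le_rpow (by linarith) (by nlinarith [hε.2, hν m]) hr
        linarith
    rw [tsum_zero] at hlim
    have h1 := hlim.eventually (ge_mem_nhds (show (0 : ℝ) < α / 4 by positivity))
    obtain ⟨ε, h, h'⟩ := (h1.and (Ioc_mem_nhdsGT (zero_lt_one (α := ℝ)))).exists
    exact ⟨ε, h'.1, h'.2, h⟩
  set ρ : G → ℝ := fun m => (1 + ε * ν m) ^ r with hρ
  have hεν : ∀ m, 0 ≤ ε * ν m := fun m => mul_nonneg hε0.le (hν m)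
  have hρ1 : ∀ m, 1 ≤ ρ m := fun m => hone (hεν m)
  have hρle : ∀ m, ρ m ≤ (1 + ν m) ^ r := fun m =>
    Real.rpow_le_rpow (by linarith [hεν m]) (by nlinarith [hν m]) hr
  have hρmul : ∀ m m', ρ (m + m') ≤ ρ m * ρ m' := by
    intro m m'
    have h0 := hεν m
    have h0' := hεν m'
    rw [hρ]
    simp only
    rw [← Real.mul_rpow (by linarith) (by linarith)]
    refine Real.rpow_le_rpow (by linarith [hεν (m + m')]) ?_ hr
    nlinarith [mul_le_mul_of_nonneg_left (hν_add m m') hε0.le, mul_nonneg h0 h0']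
  have hρneg : ∀ m, ρ (-m) = ρ m := fun m => by simp only [hρ, hν_neg]
  have hsη : Summable fun m => a m * (ρ m - 1) := by
    refine hs.of_nonneg_of_le (fun m => mul_nonneg (ha m) (by linarith [hρ1 m])) fun m => ?_
    exact mul_le_mul_of_nonneg_left (by linarith [hρle m]) (ha m)
  have hgρ : ∀ R, 0 ≤ R → Summable fun i => min (ρ (φ i)) R ^ 2 * ‖T w i‖ ^ 2 := by
    intro R hR
    refine hg.of_nonneg_of_le (fun i => by positivity) fun i => ?_
    have h0 : 0 ≤ min (ρ (φ i)) R := le_min (by linarith [hρ1 (φ i)]) hR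
    have h1 : min (ρ (φ i)) R ≤ (1 + ν (φ i)) ^ r := (min_le_left _ _).trans (hρle _)
    gcongr
  have hvar : ∀ R, 0 ≤ R → ∀ k l, |min (ρ (φ l)) R - min (ρ (φ k)) R|
      ≤ min (ρ (φ l)) R * (ρ (φ k - φ l) - 1) := by
    intro R hR k l
    -- Truncation preserves this multiplicative bound because `ρ ≥ 1`. Using it in both directions
    -- gives the bound on the oscillation of the weight.
    have key : ∀ i j, min (ρ (φ i)) R ≤ min (ρ (φ j)) R * ρ (φ i - φ j) := by
      intro i j
      have h1 : ρ (φ i) ≤ ρ (φ j) * ρ (φ i - φ j) := by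
        have := hρmul (φ j) (φ i - φ j)
        rwa [add_sub_cancel] at this
      have h2 := hρ1 (φ i - φ j)
      rw [min_mul_of_nonneg _ _ (by linarith)]
      exact min_le_min h1 (le_mul_of_one_le_right hR h2)
    have h1 := key k l
    have h2 := key l k
    rw [← neg_sub (φ k) (φ l), hρneg] at h2
    have h3 := hρ1 (φ k - φ l)
    have h4 : 0 ≤ min (ρ (φ l)) R := le_min (by linarith [hρ1 (φ l)]) hR
    have h5 : 0 ≤ min (ρ (φ k)) R := le_min (by linarith [hρ1 (φ k)]) hR
    rw [abs_le]
    refine ⟨by linarith, ?_⟩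
    by_cases h : min (ρ (φ l)) R ≤ min (ρ (φ k)) R
    · nlinarith
    · push Not at h
      nlinarith
  have hest : ∀ R, 0 ≤ R → ∑' i, min (ρ (φ i)) R ^ 2 * ‖w i‖ ^ 2 ≤
      2 / α ^ 2 * ∑' i, ((1 + ν (φ i)) ^ r) ^ 2 * ‖T w i‖ ^ 2 := by
    intro R hR
    refine (weighted_estimate_of_bounded_weight hφ ha ha_sum T hT hα hcoer
      (η := fun m => ρ m - 1) (fun m => by linarith [hρ1 m]) hsη hε
      (fun i => le_min (by linarith [hρ1 (φ i)]) hR) (fun i => min_le_right _ R)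
      (hvar R hR) w (hgρ R hR)).trans ?_
    refine mul_le_mul_of_nonneg_left ((hgρ R hR).tsum_le_tsum (fun i => ?_) hg) (by positivity)
    have h0 : 0 ≤ min (ρ (φ i)) R := le_min (by linarith [hρ1 (φ i)]) hR
    have h1 : min (ρ (φ i)) R ≤ (1 + ν (φ i)) ^ r := (min_le_left _ _).trans (hρle _)
    gcongr
  have hρsum : Summable fun i => ρ (φ i) ^ 2 * ‖w i‖ ^ 2 := by
    refine summable_of_sum_le (c := 2 / α ^ 2 * ∑' i, ((1 + ν (φ i)) ^ r) ^ 2 * ‖T w i‖ ^ 2)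
      (fun i => by positivity) fun t => ?_
    -- With `R = ∑ i ∈ t, ρ (φ i)` the truncation is inactive on `t`, so the bound uniform in `R`
    -- controls every finite partial sum.
    have hR : 0 ≤ ∑ i ∈ t, ρ (φ i) := Finset.sum_nonneg fun i _ => by linarith [hρ1 (φ i)]
    refine le_trans ?_ (hest _ hR)
    have hsum : Summable fun i => min (ρ (φ i)) (∑ i ∈ t, ρ (φ i)) ^ 2 * ‖w i‖ ^ 2 := by
      refine ((summable_norm_sq_coe w).mul_left ((∑ i ∈ t, ρ (φ i)) ^ 2)).of_nonneg_of_le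
        (fun i => by positivity) fun i => ?_
      have h0 : 0 ≤ min (ρ (φ i)) (∑ i ∈ t, ρ (φ i)) := le_min (by linarith [hρ1 (φ i)]) hR
      have h1 := min_le_right (ρ (φ i)) (∑ i ∈ t, ρ (φ i))
      gcongr
    refine le_trans (Finset.sum_le_sum fun i hi => ?_)
      (hsum.sum_le_tsum t fun i _ => by positivity)
    rw [min_eq_left (Finset.single_le_sum (f := fun i => ρ (φ i))
      (fun i _ => by linarith [hρ1 (φ i)]) hi)]
  refine (hρsum.mul_left ((ε ^ r)⁻¹ ^ 2)).of_nonneg_of_le (fun i => by positivity) fun i => ?_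
  have hεr : 0 < ε ^ r := Real.rpow_pos_of_pos hε0 r
  -- Since `ε ≤ 1`, `ε (1 + ν) ≤ 1 + ε ν`: the slow weight is comparable to the original one.
  have h1 : (1 + ν (φ i)) ^ r ≤ (ε ^ r)⁻¹ * ρ (φ i) := by
    rw [← div_eq_inv_mul, le_div_iff₀ hεr, ← Real.mul_rpow (by linarith [hν (φ i)]) hε0.le]
    exact Real.rpow_le_rpow (by nlinarith [hν (φ i)]) (by nlinarith [hν (φ i)]) hr
  have h2 : 0 ≤ (1 + ν (φ i)) ^ r := by linarith [hone (hν (φ i))]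
  calc _ ≤ ((ε ^ r)⁻¹ * ρ (φ i)) ^ 2 * ‖w i‖ ^ 2 := by gcongr
    _ = _ := by ring

/-! ### Multiplication operators on `L²(𝕋ⁿ)` -/

theorem characterL2_coeFn {n : ℕ} (k : Fin n → ℤ) :
    characterL2 k =ᵐ[torusMeasure n] character k :=
  ContinuousMap.coeFn_toLp (p := 2) (torusMeasure n) (𝕜 := ℂ) (character k)

theorem conj_character_sub {n : ℕ} (k l : Fin n → ℤ) (y : Torus n) :
    conj (character (k - l) y) = character l y * conj (character k y) := by
  simp only [character, ContinuousMap.coe_mk, map_prod, ← Finset.prod_mul_distrib,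
    ← fourier_neg, ← fourier_add, Pi.sub_apply, sub_eq_add_neg, neg_add_rev, neg_neg]

theorem memLp_top_of_le_of_le {n : ℕ} {A : Torus n → ℝ} {α₀ α₁ : ℝ}
    (hA : AEMeasurable A (torusMeasure n)) (hb : ∀ y, α₀ ≤ A y ∧ A y ≤ α₁) :
    MemLp (fun y => (A y : ℂ)) ⊤ (torusMeasure n) := by
  refine memLp_top_of_bound (Complex.measurable_ofReal.comp_aemeasurable hA).aestronglyMeasurable
    (max |α₀| |α₁|) (Eventually.of_forall fun y => ?_)
  rw [Complex.norm_real, Real.norm_eq_abs]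
  exact abs_le_max_abs_abs (hb y).1 (hb y).2

/-- Multiplication by a bounded function on `L²(𝕋ⁿ)`. -/
def mulOperator {n : ℕ} {b : Torus n → ℂ} (hb : MemLp b ⊤ (torusMeasure n)) :
    Lp ℂ 2 (torusMeasure n) →L[ℂ] Lp ℂ 2 (torusMeasure n) :=
  (ContinuousLinearMap.mul ℂ ℂ).holderL (torusMeasure n) ⊤ 2 2 hb.toLp

theorem mulOperator_coeFn {n : ℕ} {b : Torus n → ℂ} (hb : MemLp b ⊤ (torusMeasure n))
    (f : Lp ℂ 2 (torusMeasure n)) :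
    mulOperator hb f =ᵐ[torusMeasure n] fun y => b y * f y := by
  have h := ContinuousLinearMap.coeFn_holder (r := 2) (ContinuousLinearMap.mul ℂ ℂ)
    (hb.toLp (f := b)) f
  filter_upwards [h, hb.coeFn_toLp] with y h1 h2
  rw [← h2]
  exact h1

theorem inner_mulOperator {n : ℕ} {b : Torus n → ℂ} (hb : MemLp b ⊤ (torusMeasure n))
    (f g : Lp ℂ 2 (torusMeasure n)) :
    Integrable (fun y => b y * (g y * conj (f y))) (torusMeasure n) ∧
      inner ℂ f (mulOperator hb g) = ∫ y, b y * (g y * conj (f y)) ∂(torusMeasure n) := by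
  have h : (fun y => inner ℂ (f y) (mulOperator hb g y))
      =ᵐ[torusMeasure n] fun y => b y * (g y * conj (f y)) := by
    filter_upwards [mulOperator_coeFn hb g] with y hy
    rw [hy, RCLike.inner_apply, mul_assoc]
  exact ⟨(L2.integrable_inner f (mulOperator hb g)).congr h, by
    rw [L2.inner_def, integral_congr_ae h]⟩

/-- Multiplication is a Toeplitz (convolution) matrix in the basis of characters; this is where
Fourier decay becomes off-diagonal decay. -/
theorem inner_characterL2_mulOperator {n : ℕ} {b : Torus n → ℂ}
    (hb : MemLp b ⊤ (torusMeasure n)) (k l : Fin n → ℤ) :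
    inner ℂ (characterL2 k) (mulOperator hb (characterL2 l)) = fourierCoefficient b (k - l) := by
  rw [(inner_mulOperator hb _ _).2, fourierCoefficient]
  refine integral_congr_ae ?_
  filter_upwards [characterL2_coeFn k, characterL2_coeFn l] with y h1 h2
  rw [h1, h2, conj_character_sub]

theorem le_re_inner_mulOperator {n : ℕ} {A : Torus n → ℝ} {α₀ : ℝ} (hA : ∀ y, α₀ ≤ A y)
    (hb : MemLp (fun y => (A y : ℂ)) ⊤ (torusMeasure n)) (f : Lp ℂ 2 (torusMeasure n)) :
    α₀ * ‖f‖ ^ 2 ≤ (inner ℂ f (mulOperator hb f)).re := by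
  obtain ⟨hi, he⟩ := inner_mulOperator hb f f
  have h1 : (‖f‖ ^ 2 : ℝ) = (inner ℂ f f).re := by
    rw [← inner_self_eq_norm_sq (𝕜 := ℂ)]; rfl
  have hre : ∀ {φ : Torus n → ℂ}, Integrable φ (torusMeasure n) →
      (∫ y, φ y ∂(torusMeasure n)).re = ∫ y, (φ y).re ∂(torusMeasure n) := fun hφ =>
    (integral_re hφ).symm
  have hff := L2.integrable_inner (𝕜 := ℂ) f f
  rw [h1, he, L2.inner_def, hre hi, hre hff, ← integral_const_mul]
  refine integral_mono (hff.re.const_mul α₀) hi.re fun y => ?_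
  have e : f y * conj (f y) = ((‖f y‖ ^ 2 : ℝ) : ℂ) := by
    rw [Complex.mul_conj, Complex.normSq_eq_norm_sq]
  simp only [RCLike.inner_apply, e]
  rw [← Complex.ofReal_mul, Complex.ofReal_re, Complex.ofReal_re]
  exact mul_le_mul_of_nonneg_right (hA y) (sq_nonneg _)

/-! ### The gradient as an isometry -/

/-- The nonzero frequencies. -/
abbrev NonzeroFreq (n : ℕ) : Type := {k : Fin n → ℤ // k ≠ 0}

/-- The normalized projected frequency `P k / |P k|`. -/
def unitFreq {d n : ℕ} (P : Matrix (Fin d) (Fin n) ℝ) (k : Fin n → ℤ) :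
    EuclideanSpace ℝ (Fin d) :=
  ‖projFreq P k‖⁻¹ • projFreq P k

theorem norm_unitFreq {d n : ℕ} {P : Matrix (Fin d) (Fin n) ℝ} {k : Fin n → ℤ}
    (hk : 0 < ‖projFreq P k‖) : ‖unitFreq P k‖ = 1 := by
  rw [unitFreq, norm_smul, norm_inv, norm_norm, inv_mul_cancel₀ hk.ne']

/-- The normalized gradient of the character with frequency `k`. -/
def unitGrad {d n : ℕ} (P : Matrix (Fin d) (Fin n) ℝ) (k : NonzeroFreq n) :
    PiLp 2 fun _ : Fin d => Lp ℂ 2 (torusMeasure n) :=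
  WithLp.toLp 2 fun j => (Complex.I * (unitFreq P k j : ℂ)) • characterL2 k.1

theorem sum_unitFreq {d n : ℕ} (P : Matrix (Fin d) (Fin n) ℝ) (k l : Fin n → ℤ) :
    ∑ j, conj (Complex.I * (unitFreq P k j : ℂ)) * (Complex.I * (unitFreq P l j : ℂ))
      = ((inner ℝ (unitFreq P k) (unitFreq P l) : ℝ) : ℂ) := by
  rw [PiLp.inner_apply, Complex.ofReal_sum]
  refine Finset.sum_congr rfl fun j _ => ?_
  simp only [map_mul, Complex.conj_I, Complex.conj_ofReal, RCLike.inner_apply, conj_trivial,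
    Complex.ofReal_mul]
  linear_combination (-(unitFreq P k j : ℂ) * unitFreq P l j) * Complex.I_mul_I

/-- The inner product factors into that of the unit vectors `Pk / |Pk|` and that of the characters.
The second factor vanishes off the diagonal and the first is `1` on it. -/
theorem orthonormal_unitGrad {d n : ℕ} {P : Matrix (Fin d) (Fin n) ℝ}
    (hP : ∀ k : Fin n → ℤ, k ≠ 0 → 0 < ‖projFreq P k‖) : Orthonormal ℂ (unitGrad P) := by
  rw [orthonormal_iff_ite]
  intro k l
  have h : inner ℂ (unitGrad P k) (unitGrad P l) =
      (inner ℝ (unitFreq P k) (unitFreq P l) : ℝ) * inner ℂ (characterL2 k.1) (characterL2 l.1) := by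
    rw [← sum_unitFreq, PiLp.inner_apply, Finset.sum_mul]
    refine Finset.sum_congr rfl fun j _ => ?_
    simp only [unitGrad, inner_smul_left, inner_smul_right]
    ring
  rw [h, orthonormal_iff_ite.mp (orthonormal_characterL2 n)]
  by_cases hkl : k = l
  · subst hkl
    simp [norm_unitFreq (hP k k.2)]
  · simp [hkl, Subtype.ext_iff.not.mp hkl]

/-- The `j`-th component of the gradient of the function `∑_k |P k|⁻¹ w_k e^{i k·y}`. -/
def gradComponent {d n : ℕ} {P : Matrix (Fin d) (Fin n) ℝ}
    (hP : ∀ k : Fin n → ℤ, k ≠ 0 → 0 < ‖projFreq P k‖) (j : Fin d) :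
    lp (fun _ : NonzeroFreq n => ℂ) 2 →L[ℂ] Lp ℂ 2 (torusMeasure n) :=
  (PiLp.proj 2 (fun _ : Fin d => Lp ℂ 2 (torusMeasure n)) j : _ →L[ℂ] _) ∘L
    (orthonormal_unitGrad hP).orthogonalFamily.linearIsometry.toContinuousLinearMap

variable {d n : ℕ} {P : Matrix (Fin d) (Fin n) ℝ}

theorem hasSum_gradComponent (hP : ∀ k : Fin n → ℤ, k ≠ 0 → 0 < ‖projFreq P k‖)
    (j : Fin d) (w : lp (fun _ : NonzeroFreq n => ℂ) 2) :
    HasSum (fun k : NonzeroFreq n =>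
      (Complex.I * (unitFreq P k j : ℂ) * w k) • characterL2 k.1) (gradComponent hP j w) := by
  have h := ((orthonormal_unitGrad hP).orthogonalFamily.hasSum_linearIsometry w).mapL
    (PiLp.proj 2 (fun _ : Fin d => Lp ℂ 2 (torusMeasure n)) j : _ →L[ℂ] _)
  convert h using 2 with k
  · simp [unitGrad, smul_smul, mul_comm]
  · rfl

theorem gradComponent_single (hP : ∀ k : Fin n → ℤ, k ≠ 0 → 0 < ‖projFreq P k‖)
    (j : Fin d) (k : NonzeroFreq n) :
    gradComponent hP j (lp.single 2 k (1 : ℂ))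
      = (Complex.I * (unitFreq P k j : ℂ)) • characterL2 k.1 := by
  simp [gradComponent, unitGrad]

theorem sum_norm_sq_gradComponent (hP : ∀ k : Fin n → ℤ, k ≠ 0 → 0 < ‖projFreq P k‖)
    (w : lp (fun _ : NonzeroFreq n => ℂ) 2) :
    ∑ j, ‖gradComponent hP j w‖ ^ 2 = ‖w‖ ^ 2 := by
  rw [← (orthonormal_unitGrad hP).orthogonalFamily.linearIsometry.norm_map w,
    PiLp.norm_sq_eq_of_L2]
  rfl

/-- The operator on `ℓ²` representing the energy form. -/
def energyOperator (hP : ∀ k : Fin n → ℤ, k ≠ 0 → 0 < ‖projFreq P k‖)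
    {b : Torus n → ℂ} (hb : MemLp b ⊤ (torusMeasure n)) :
    lp (fun _ : NonzeroFreq n => ℂ) 2 →L[ℂ] lp (fun _ : NonzeroFreq n => ℂ) 2 :=
  ∑ j, (gradComponent hP j).adjoint ∘L mulOperator hb ∘L gradComponent hP j

theorem inner_energyOperator (hP : ∀ k : Fin n → ℤ, k ≠ 0 → 0 < ‖projFreq P k‖)
    {b : Torus n → ℂ} (hb : MemLp b ⊤ (torusMeasure n))
    (v w : lp (fun _ : NonzeroFreq n => ℂ) 2) :
    inner ℂ v (energyOperator hP hb w)
      = ∑ j, inner ℂ (gradComponent hP j v) (mulOperator hb (gradComponent hP j w)) := by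
  simp [energyOperator, ContinuousLinearMap.adjoint_inner_right]

theorem le_re_inner_energyOperator (hP : ∀ k : Fin n → ℤ, k ≠ 0 → 0 < ‖projFreq P k‖)
    {A : Torus n → ℝ} {α₀ : ℝ} (hA : ∀ y, α₀ ≤ A y)
    (hb : MemLp (fun y => (A y : ℂ)) ⊤ (torusMeasure n))
    (w : lp (fun _ : NonzeroFreq n => ℂ) 2) :
    α₀ * ‖w‖ ^ 2 ≤ (inner ℂ w (energyOperator hP hb w)).re := by
  rw [inner_energyOperator, ← sum_norm_sq_gradComponent hP, Finset.mul_sum, Complex.re_sum]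
  exact Finset.sum_le_sum fun j _ => le_re_inner_mulOperator hA hb _

/-- The entry equals `⟨e_k, e_l⟩ b̂_{k-l}` with unit vectors `e_k = Pk / |Pk|`, so Cauchy–Schwarz
removes all dependence on `P`. -/
theorem norm_energyOperator_entry_le (hP : ∀ k : Fin n → ℤ, k ≠ 0 → 0 < ‖projFreq P k‖)
    {b : Torus n → ℂ} (hb : MemLp b ⊤ (torusMeasure n))
    (k l : NonzeroFreq n) :
    ‖inner ℂ (lp.single 2 k (1 : ℂ) : lp (fun _ : NonzeroFreq n => ℂ) 2)
      (energyOperator hP hb (lp.single 2 l (1 : ℂ)))‖ ≤ ‖fourierCoefficient b (k.1 - l.1)‖ := by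
  have h : inner ℂ (lp.single 2 k (1 : ℂ) : lp (fun _ : NonzeroFreq n => ℂ) 2)
      (energyOperator hP hb (lp.single 2 l (1 : ℂ)))
      = (inner ℝ (unitFreq P k) (unitFreq P l) : ℝ) * fourierCoefficient b (k.1 - l.1) := by
    rw [inner_energyOperator, ← sum_unitFreq, Finset.sum_mul]
    refine Finset.sum_congr rfl fun j _ => ?_
    rw [gradComponent_single, gradComponent_single, map_smul, inner_smul_left, inner_smul_right,
      inner_characterL2_mulOperator]
    ring
  rw [h, norm_mul, Complex.norm_real]
  refine mul_le_of_le_one_left (norm_nonneg _) ((norm_inner_le_norm _ _).trans ?_)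
  rw [norm_unitFreq (hP k k.2), norm_unitFreq (hP l l.2), one_mul]

/-! ### Correspondence between `ℓ²` and the projected Sobolev space -/

theorem hasSum_nonzeroFreq_iff {E : Type*} [AddCommMonoid E] [TopologicalSpace E]
    {f : (Fin n → ℤ) → E} (h0 : f 0 = 0) {x : E} :
    HasSum (fun k : NonzeroFreq n => f k) x ↔ HasSum f x :=
  Subtype.val_injective.hasSum_iff fun k hk => by
    have : k = 0 := by simpa using hk
    rw [this, h0]

theorem summable_nonzeroFreq_iff {f : (Fin n → ℤ) → ℝ} (h0 : f 0 = 0) :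
    Summable (fun k : NonzeroFreq n => f k) ↔ Summable f :=
  Subtype.val_injective.summable_iff fun k hk => by
    have : k = 0 := by simpa using hk
    rw [this, h0]

theorem mem_projSobolevZero_one_iff {U : FourierSeries n} :
    U ∈ projSobolevZero P 1 ↔
      U 0 = 0 ∧ Summable fun k : NonzeroFreq n => ‖(‖projFreq P k‖ : ℂ) * U k‖ ^ 2 := by
  refine and_congr_right fun h0 => ?_
  rw [← summable_nonzeroFreq_iff (by simp [h0])]
  refine summable_congr fun k => ?_
  rw [norm_mul, Complex.norm_real, norm_norm, mul_pow, mul_one]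
  congr 1
  exact_mod_cast Real.rpow_natCast _ 2

/-- The square-summable sequence `|P k| Û_k` associated to `U ∈ H̄¹_{P,0}`. -/
def gradCoeff {U : FourierSeries n} (hU : U ∈ projSobolevZero P 1) :
    lp (fun _ : NonzeroFreq n => ℂ) 2 :=
  ⟨fun k => (‖projFreq P k‖ : ℂ) * U k,
    memℓp_two_of_summable (mem_projSobolevZero_one_iff.mp hU).2⟩

/-- The series `U` with prescribed `|P k| Û_k`. -/
def ofGradCoeff (P : Matrix (Fin d) (Fin n) ℝ) (w : lp (fun _ : NonzeroFreq n => ℂ) 2) :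
    FourierSeries n :=
  fun k => if h : k ≠ 0 then (‖projFreq P k‖ : ℂ)⁻¹ * w ⟨k, h⟩ else 0

theorem ofGradCoeff_coe (w : lp (fun _ : NonzeroFreq n => ℂ) 2) (k : NonzeroFreq n) :
    ofGradCoeff P w k = (‖projFreq P k‖ : ℂ)⁻¹ * w k := by
  rw [ofGradCoeff, dif_pos k.2]

theorem ofGradCoeff_mem (hP : ∀ k : Fin n → ℤ, k ≠ 0 → 0 < ‖projFreq P k‖)
    (w : lp (fun _ : NonzeroFreq n => ℂ) 2) :
    ofGradCoeff P w ∈ projSobolevZero P 1 := by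
  refine mem_projSobolevZero_one_iff.mpr ⟨by simp [ofGradCoeff], ?_⟩
  refine (summable_norm_sq_coe w).congr fun k => ?_
  have := Complex.ofReal_ne_zero.mpr (hP k k.2).ne'
  rw [ofGradCoeff_coe, mul_inv_cancel_left₀ this]

theorem gradCoeff_ofGradCoeff (hP : ∀ k : Fin n → ℤ, k ≠ 0 → 0 < ‖projFreq P k‖)
    (w : lp (fun _ : NonzeroFreq n => ℂ) 2) :
    gradCoeff (ofGradCoeff_mem hP w) = w := by
  ext k
  have := Complex.ofReal_ne_zero.mpr (hP k k.2).ne'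
  change (‖projFreq P k‖ : ℂ) * ofGradCoeff P w k = w k
  rw [ofGradCoeff_coe, mul_inv_cancel_left₀ this]

theorem ofGradCoeff_gradCoeff (hP : ∀ k : Fin n → ℤ, k ≠ 0 → 0 < ‖projFreq P k‖)
    {U : FourierSeries n} (hU : U ∈ projSobolevZero P 1) :
    ofGradCoeff P (gradCoeff hU) = U := by
  funext k
  by_cases hk : k = 0
  · subst hk; simp [ofGradCoeff, hU.1]
  · have := Complex.ofReal_ne_zero.mpr (hP k hk).ne'
    rw [ofGradCoeff, dif_pos hk]
    change (‖projFreq P k‖ : ℂ)⁻¹ * ((‖projFreq P k‖ : ℂ) * U k) = U k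
    rw [inv_mul_cancel_left₀ this]

theorem gradComponent_gradCoeff (hP : ∀ k : Fin n → ℤ, k ≠ 0 → 0 < ‖projFreq P k‖)
    {U : FourierSeries n} (hU : U ∈ projSobolevZero P 1)
    (j : Fin d) : gradComponent hP j (gradCoeff hU) = projGrad P U j := by
  refine (hasSum_gradComponent hP j _).unique ?_
  have h := (hasSum_nonzeroFreq_iff (by simp [hU.1])).mpr (hasSum_projGrad hU j)
  convert h using 2 with k
  have := Complex.ofReal_ne_zero.mpr (hP k k.2).ne'
  change (Complex.I * ((‖projFreq P k‖⁻¹ * projFreq P k j : ℝ) : ℂ) *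
    ((‖projFreq P k‖ : ℂ) * U k)) • _ = _
  congr 1
  push_cast
  field_simp

/-- In the coordinates `|Pk| Û_k` the gradient is an isometry, which carries the variational problem
over to ℓ². -/
theorem energyForm_eq_inner (hP : ∀ k : Fin n → ℤ, k ≠ 0 → 0 < ‖projFreq P k‖)
    {A : Torus n → ℝ}
    (hb : MemLp (fun y => (A y : ℂ)) ⊤ (torusMeasure n)) {U V : FourierSeries n}
    (hU : U ∈ projSobolevZero P 1) (hV : V ∈ projSobolevZero P 1) :
    energyForm P A U V = inner ℂ (gradCoeff hV) (energyOperator hP hb (gradCoeff hU)) := by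
  rw [inner_energyOperator, energyForm]
  simp only [gradComponent_gradCoeff]
  simp only [fun j => (inner_mulOperator hb (projGrad P V j) (projGrad P U j)).2]
  rw [← integral_finsetSum _ fun j _ => (inner_mulOperator hb _ _).1]
  simp only [Finset.mul_sum]

/-! ### Consequences of the Diophantine estimate -/

theorem norm_projFreq_pos {d n : ℕ} {P : Matrix (Fin d) (Fin n) ℝ} {c τ : ℝ} (hc : 0 < c)
    (h : IsDiophantine P c τ) {k : Fin n → ℤ} (hk : k ≠ 0) : 0 < ‖projFreq P k‖ :=
  (mul_pos hc (Real.rpow_pos_of_pos (norm_freq_pos hk) _)).trans_le (h k hk)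

/-- Passing from `|k|` to `1 + |k|` only weakens the lower bound and matches the weights used on ℓ²:
each division by `|Pk|` costs `τ` powers. -/
theorem inv_norm_projFreq_le {d n : ℕ} {P : Matrix (Fin d) (Fin n) ℝ} {c τ : ℝ} (hc : 0 < c)
    (hτ : 0 ≤ τ) (h : IsDiophantine P c τ) {k : Fin n → ℤ} (hk : k ≠ 0) :
    ‖projFreq P k‖⁻¹ ≤ c⁻¹ * (1 + ‖freq k‖) ^ τ := by
  have h1 := norm_freq_pos hk
  have h2 : c * (1 + ‖freq k‖) ^ (-τ) ≤ ‖projFreq P k‖ := by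
    refine le_trans ?_ (h k hk)
    exact mul_le_mul_of_nonneg_left (Real.rpow_le_rpow_of_nonpos h1 (by linarith) (by linarith))
      hc.le
  have h3 : 0 < (1 + ‖freq k‖) ^ (-τ) := Real.rpow_pos_of_pos (by linarith) _
  refine (inv_anti₀ (mul_pos hc h3) h2).trans_eq ?_
  rw [mul_inv, Real.rpow_neg (by linarith), inv_inv]

theorem sq_rpow {x : ℝ} (hx : 0 ≤ x) (r : ℝ) : (x ^ r) ^ 2 = (x ^ 2) ^ r := by
  rw [← Real.rpow_natCast, ← Real.rpow_natCast, ← Real.rpow_mul hx, ← Real.rpow_mul hx, mul_comm]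

end Quasiperiodic

end

/-! ### Existence, uniqueness and regularity of the solution -/

open Quasiperiodic in
theorem theorem3p3 {d n : ℕ}
    (P : Matrix (Fin d) (Fin n) ℝ) (hP : Quasiperiodic.IsProjectionMatrix P)
    (c τ : ℝ) (hc : 0 < c) (hτ : 0 < τ) (hDioph : Quasiperiodic.IsDiophantine P c τ)
    (A : Quasiperiodic.Torus n → ℝ)
    (hA_meas : AEMeasurable A (Quasiperiodic.torusMeasure n))
    (α₀ α₁ : ℝ) (hα₀ : 0 < α₀) (hA_bound : ∀ y, α₀ ≤ A y ∧ A y ≤ α₁)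
    (s N : ℝ) (hs : 0 ≤ s) (hN : (n : ℝ) + s + τ < N)
    (hA_decay : Quasiperiodic.HasFourierDecay A N)
    (F : Quasiperiodic.FourierSeries n) (hF : F ∈ Quasiperiodic.sobolevZero n (2 * τ + s)) :
    ∃ U : Quasiperiodic.FourierSeries n,
      Quasiperiodic.IsSolution P A F U ∧ U ∈ Quasiperiodic.sobolevZero n s ∧
        ∀ U' : Quasiperiodic.FourierSeries n, Quasiperiodic.IsSolution P A F U' → U' = U := by
  have hpos : ∀ k : Fin n → ℤ, k ≠ 0 → 0 < ‖projFreq P k‖ := fun k hk =>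
    norm_projFreq_pos hc hDioph hk
  have hb := memLp_top_of_le_of_le hA_meas hA_bound
  have hx1 : ∀ k : Fin n → ℤ, 1 ≤ 1 + ‖freq k‖ := fun k => by linarith [norm_nonneg (freq k)]
  have hx0 : ∀ k : Fin n → ℤ, 0 < 1 + ‖freq k‖ := fun k => by linarith [hx1 k]
  -- the right-hand side as an element of `ℓ²`
  have hg : Summable fun k : NonzeroFreq n => ((1 + ‖freq k.1‖) ^ (s + τ)) ^ 2 *
      ‖(‖projFreq P k.1‖ : ℂ)⁻¹ * F k.1‖ ^ 2 := by
    -- The factor `c⁻¹ ^ 2` comes from dividing by `|Pk|`, and `2 ^ (2 * τ + s)` from `(1 + x)² ≤ 2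
    -- (1 + x²)`.
    refine (((hF.2.comp_injective Subtype.val_injective).mul_left
      (c⁻¹ ^ 2 * 2 ^ (2 * τ + s)))).of_nonneg_of_le (fun k => by positivity) fun k => ?_
    have h1 := inv_norm_projFreq_le hc hτ.le hDioph k.2
    have h2 : (((1 + ‖freq k.1‖) ^ (s + τ)) * (1 + ‖freq k.1‖) ^ τ) ^ 2
        ≤ 2 ^ (2 * τ + s) * (1 + ‖freq k.1‖ ^ 2) ^ (2 * τ + s) := by
      rw [← Real.rpow_add (hx0 _), sq_rpow (hx0 _).le, ← Real.mul_rpow (by norm_num) (by positivity),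
        show s + τ + τ = 2 * τ + s by ring]
      refine Real.rpow_le_rpow (by positivity) ?_ (by linarith)
      nlinarith [sq_nonneg (1 - ‖freq k.1‖)]
    rw [norm_mul, norm_inv, Complex.norm_real, norm_norm, Function.comp_apply]
    calc _ ≤ ((1 + ‖freq k.1‖) ^ (s + τ)) ^ 2 * (c⁻¹ * (1 + ‖freq k.1‖) ^ τ * ‖F k.1‖) ^ 2 := by
          gcongr
      _ = c⁻¹ ^ 2 * (((1 + ‖freq k.1‖) ^ (s + τ)) * (1 + ‖freq k.1‖) ^ τ) ^ 2 * ‖F k.1‖ ^ 2 := by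
          ring
      _ ≤ c⁻¹ ^ 2 * (2 ^ (2 * τ + s) * (1 + ‖freq k.1‖ ^ 2) ^ (2 * τ + s)) * ‖F k.1‖ ^ 2 := by
          gcongr
      _ = _ := by ring
  have hg2 : Summable fun k : NonzeroFreq n => ‖(‖projFreq P k.1‖ : ℂ)⁻¹ * F k.1‖ ^ 2 :=
    hg.of_nonneg_of_le (fun k => by positivity) fun k =>
      le_mul_of_one_le_left (by positivity)
        (one_le_pow₀ (Real.one_le_rpow (hx1 k.1) (by linarith)))
  let g : lp (fun _ : NonzeroFreq n => ℂ) 2 := ⟨_, memℓp_two_of_summable hg2⟩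
  -- The factors `|Pk|` and `|Pk|⁻¹` cancel, so `⟨F, V⟩` is an ℓ² inner product and its convergence
  -- comes for free.
  have hpair : ∀ {V : FourierSeries n} (hV : V ∈ projSobolevZero P 1),
      HasSum (fun k => F k * conj (V k)) (inner ℂ (gradCoeff hV) g) := by
    intro V hV
    rw [← hasSum_nonzeroFreq_iff (by simp [hV.1])]
    have h : (fun k : NonzeroFreq n => F k * conj (V k))
        = fun k => inner ℂ (gradCoeff hV k) (g k) := by
      funext k
      have hk := Complex.ofReal_ne_zero.mpr (hpos k k.2).ne'
      change _ = inner ℂ ((‖projFreq P k‖ : ℂ) * V k) ((‖projFreq P k‖ : ℂ)⁻¹ * F k)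
      rw [RCLike.inner_apply, map_mul, Complex.conj_ofReal]
      field_simp
    rw [h]
    exact lp.hasSum_inner (gradCoeff hV) g
  set T := energyOperator hpos hb with hT
  have hcoer : ∀ w, α₀ * ‖w‖ ^ 2 ≤ (inner ℂ w (T w)).re :=
    le_re_inner_energyOperator hpos (fun y => (hA_bound y).1) hb
  -- Lax–Milgram: the coercivity bound makes `T` invertible.
  have hunit : IsUnit T := by
    refine ContinuousLinearMap.isUnit_of_forall_le_norm_inner_map T (c := ⟨α₀, hα₀.le⟩) hα₀
      fun w => ?_
    rw [norm_inner_symm, mul_comm]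
    exact (hcoer w).trans (Complex.re_le_norm _)
  have hbij := ContinuousLinearMap.isUnit_iff_bijective.mp hunit
  obtain ⟨w, hw⟩ := hbij.2 g
  refine ⟨ofGradCoeff P w, ⟨ofGradCoeff_mem hpos w, fun V hV => ?_⟩,
    ⟨by simp [ofGradCoeff], ?_⟩, fun U' hU' => ?_⟩
  · rw [energyForm_eq_inner hpos hb (ofGradCoeff_mem hpos w) hV, gradCoeff_ofGradCoeff hpos, ← hT, hw]
    exact hpair hV
  · obtain ⟨C, hC, hdecay⟩ := hA_decay
    have hsum : Summable fun m : Fin n → ℤ =>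
        C * (1 + ‖freq m‖) ^ (-N) * (1 + ‖freq m‖) ^ (s + τ) := by
      -- The combined exponent is `-(N - (s + τ))`, and `N - (s + τ) > n`.
      refine ((summable_one_add_norm_freq_rpow (n := n) (p := N - (s + τ))
        (by linarith)).mul_left C).congr fun m => ?_
      rw [mul_assoc, ← Real.rpow_add (hx0 m)]
      ring_nf
    have hreg := summable_weighted_of_coercive (φ := fun k : NonzeroFreq n => k.1)
      Subtype.val_injective (ν := fun m => ‖freq m‖) (fun m => by positivity)
      (fun m => norm_nonneg _) (fun m => by rw [freq_neg, norm_neg])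
      (fun m m' => by rw [freq_add]; exact norm_add_le _ _)
      (by linarith) hsum T
      (fun k l => (norm_energyOperator_entry_le hpos hb k l).trans (hdecay _)) hα₀ hcoer w
      (by rw [hw]; exact hg)
    rw [← summable_nonzeroFreq_iff (by simp [ofGradCoeff])]
    -- Of the `s + τ` powers gained for `w`, `τ` are spent on dividing by `|Pk|`.
    refine (hreg.mul_left (c⁻¹ ^ 2)).of_nonneg_of_le (fun k => by positivity) fun k => ?_
    have h1 := inv_norm_projFreq_le hc hτ.le hDioph k.2
    have h2 : (1 + ‖freq k.1‖ ^ 2) ^ s ≤ ((1 + ‖freq k.1‖) ^ s) ^ 2 := by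
      rw [sq_rpow (hx0 _).le]
      refine Real.rpow_le_rpow (by positivity) ?_ hs
      nlinarith [norm_nonneg (freq k.1)]
    rw [ofGradCoeff_coe, norm_mul, norm_inv, Complex.norm_real, norm_norm, Real.rpow_add (hx0 _)]
    calc _ ≤ ((1 + ‖freq k.1‖) ^ s) ^ 2 * (c⁻¹ * (1 + ‖freq k.1‖) ^ τ * ‖w k‖) ^ 2 := by gcongr
      _ = _ := by ring
  -- Every `v` in ℓ² comes from an admissible test series, so a second solution satisfies the same
  -- operator equation and injectivity of `T` applies.
  · have hw' : T (gradCoeff hU'.1) = g := by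
      refine ext_inner_left ℂ fun v => ?_
      have hv := ofGradCoeff_mem hpos v
      have h := (hU'.2 _ hv).unique (hpair hv)
      rwa [energyForm_eq_inner hpos hb hU'.1 hv, gradCoeff_ofGradCoeff hpos] at h
    rw [← ofGradCoeff_gradCoeff hpos hU'.1, hbij.1 (hw'.trans hw.symm)]
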